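/- A finite valuation ring is a finite commutative local ring with identity in which every ideal is principal; if $q$ is the number of elements of its residue field, its order is $q^r$ for some integer $r\ge 1$. For a subset $A$ of such a ring $R$, write $A+A=\{a+b : a,b\in A\}$, $A^2=\{x^2 : x\in A\}$, and $A^2+A^2=\{x^2+y^2 : x,y\in A\}$. **Theorem.** For every real $C>0$ there is a real $c>0$, depending only on $C$, such that the following holds. Let $R$ be a finite valuation ring of order $q^r$, where $q$, the order of its residue field, is odd (hence a power of an odd prime). Let $A\subset R$ satisfy $$|A|\ge 2q^{r-1}\qquad\text{and}\qquad |A+A|\,|A|^2\ge C\,q^{3r-1}.$$ Then $$\max\{|A+A|,\ |A^2+A^2|\}\ \ge\ c\,q^{r/3}|A|^{2/3}.$$ -/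

import Mathlib

open scoped Pointwise

/-- For a finite set `A` of ring elements, the set `A² = {x² : x ∈ A}` of its squares.
(This is not the pointwise power `A ^ 2 = A * A`.) -/
def squareSet {R : Type*} [CommRing R] [DecidableEq R] (A : Finset R) : Finset R :=
  A.image (fun x => x ^ 2)

/-! For `b ∈ A` and `w ∈ A²`, the parabola `t = (s - b)² + w` meets `(A + A) × (A² + A²)` in at
least `|A|` points, namely `s = a + b`, `t = a² + w`. Shearing by `s²` turns these parabolas into
lines. Points whose abscissas differ by a unit share at most one line, so incidences have small
variance (`sum_card_pointsOn_sub_sq_le`): either rich lines are few or the average line is already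
rich. Since squaring is at most two-to-one on units, `|A²| ≥ |A|/4`; `le_max_cube` then combines the
bounds. -/

section Incidence

variable {R : Type*} [CommRing R] [Fintype R] [DecidableEq R]

/-- The points `(x, y)` of `P` on the line `y = m x + k` encoded by the pair `l = (m, k)`. -/
def pointsOn (P : Finset (R × R)) (l : R × R) : Finset (R × R) :=
  {p ∈ P | p.2 = l.1 * p.1 + l.2}

theorem sum_card_pointsOn (P : Finset (R × R)) :
    ∑ l : R × R, (pointsOn P l).card = P.card * Fintype.card R := by
  have h := Finset.sum_card_bipartiteAbove_eq_sum_card_bipartiteBelow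
    (s := (Finset.univ : Finset (R × R))) (t := P)
    (fun l p => p.2 = l.1 * p.1 + l.2)
  have h2 : ∀ p ∈ P, (Finset.bipartiteBelow (fun (l p : R × R) => p.2 = l.1 * p.1 + l.2)
      Finset.univ p).card = Fintype.card R := by
    intro p _
    rw [← Finset.card_univ]
    refine Finset.card_nbij' Prod.fst (fun m => (m, p.2 - m * p.1)) ?_ ?_ ?_ ?_
    · intro l _; simp
    · intro m _; simp [Finset.bipartiteBelow]
    · intro l hl
      simp only [Finset.bipartiteBelow, Finset.coe_filter, Finset.mem_univ, true_and,
        Set.mem_ofPred_eq] at hl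
      ext <;> simp [hl]
    · intro m _; rfl
  rw [Finset.sum_congr rfl h2, Finset.sum_const, smul_eq_mul] at h
  exact h

/-- The slopes of the lines through two given points. -/
def commonSlopes (p p' : R × R) : Finset R :=
  {m | p.2 - m * p.1 = p'.2 - m * p'.1}

/-- A unit difference of abscissas determines the slope. Otherwise that difference is a nonunit and,
together with the slope, it determines `p'`. -/
theorem sum_card_commonSlopes_le (P : Finset (R × R)) (p : R × R) :
    ∑ p' ∈ P, (commonSlopes p p').card
      ≤ P.card + (nonunits R).ncard * Fintype.card R := by
  classical
  have hle : ∀ p' ∈ P, (commonSlopes p p').card ≤ 1 +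
      (if IsUnit (p'.1 - p.1) then 0 else (commonSlopes p p').card) := by
    intro p' _
    split_ifs with hu
    · rw [add_zero, Finset.card_le_one]
      intro m hm m' hm'
      simp only [commonSlopes, Finset.mem_filter, Finset.mem_univ, true_and] at hm hm'
      refine hu.mul_left_injective ?_
      linear_combination hm - hm'
    · omega
  refine (Finset.sum_le_sum hle).trans ?_
  rw [Finset.sum_add_distrib, Finset.sum_const, smul_eq_mul, mul_one]
  refine Nat.add_le_add_left ?_ _
  simp only [← ite_not (p := IsUnit _)]
  rw [← Finset.sum_filter, ← Finset.card_sigma, ← Finset.card_univ,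
    Set.ncard_eq_toFinset_card', ← Finset.card_product]
  refine Finset.card_le_card_of_injOn (fun x => (x.1.1 - p.1, x.2)) ?_ ?_
  · rintro ⟨p', m⟩ h
    simp only [Finset.coe_sigma, Set.mem_sigma_iff, Finset.mem_coe, Finset.mem_filter] at h
    simpa [mem_nonunits_iff] using h.1.2
  · rintro ⟨p', m⟩ h ⟨p'', m'⟩ h' heq
    simp only [Finset.coe_sigma, Set.mem_sigma_iff, Finset.mem_coe, Finset.mem_filter,
      commonSlopes, Finset.mem_univ, true_and] at h h'
    simp only [Prod.mk.injEq, sub_left_inj] at heq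
    obtain ⟨h1, rfl⟩ := heq
    have h2 : p'.2 = p''.2 := by
      have := h.2.symm.trans h'.2
      rw [h1] at this
      simpa using this
    have : p' = p'' := Prod.ext h1 h2
    subst this
    rfl

theorem sum_card_pointsOn_sq_le (P : Finset (R × R)) :
    ∑ l : R × R, (pointsOn P l).card ^ 2
      ≤ P.card * (P.card + (nonunits R).ncard * Fintype.card R) := by
  have h := Finset.sum_card_bipartiteAbove_eq_sum_card_bipartiteBelow
    (s := (Finset.univ : Finset (R × R))) (t := P ×ˢ P)
    (fun l x => x.1.2 = l.1 * x.1.1 + l.2 ∧ x.2.2 = l.1 * x.2.1 + l.2)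
  have h1 : ∀ l : R × R, (pointsOn P l).card ^ 2 = (Finset.bipartiteAbove
      (fun (l : R × R) (x : (R × R) × (R × R)) =>
        x.1.2 = l.1 * x.1.1 + l.2 ∧ x.2.2 = l.1 * x.2.1 + l.2) (P ×ˢ P) l).card := by
    intro l
    rw [sq, ← Finset.card_product, pointsOn, Finset.bipartiteAbove,
      ← Finset.filter_product (s := P) (t := P) (fun p => p.2 = l.1 * p.1 + l.2)
        (fun p => p.2 = l.1 * p.1 + l.2)]
  have h2 : ∀ x ∈ P ×ˢ P, (Finset.bipartiteBelow
      (fun (l : R × R) (x : (R × R) × (R × R)) =>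
        x.1.2 = l.1 * x.1.1 + l.2 ∧ x.2.2 = l.1 * x.2.1 + l.2) Finset.univ x).card
      ≤ (commonSlopes x.1 x.2).card := by
    intro x _
    refine Finset.card_le_card_of_injOn Prod.fst ?_ ?_
    · intro l hl
      simp only [Finset.bipartiteBelow, Finset.coe_filter, Finset.mem_univ, true_and,
        Set.mem_ofPred_eq] at hl
      simp [commonSlopes, hl.1, hl.2]
    · intro l hl l' hl' heq
      simp only [Finset.bipartiteBelow, Finset.coe_filter, Finset.mem_univ, true_and,
        Set.mem_ofPred_eq] at hl hl'
      have h3 := hl.1.symm.trans hl'.1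
      rw [heq] at h3
      exact Prod.ext heq (add_left_cancel h3)
  rw [Finset.sum_congr rfl fun l _ => h1 l, h]
  refine (Finset.sum_le_sum h2).trans ?_
  rw [Finset.sum_product, ← smul_eq_mul, ← Finset.sum_const]
  exact Finset.sum_le_sum fun p _ => sum_card_commonSlopes_le P p

/-- The variance of the number of points of `P` on a line `y = m x + k`. -/
theorem sum_card_pointsOn_sub_sq_le (P : Finset (R × R)) :
    ∑ l : R × R, (((pointsOn P l).card : ℝ) - P.card / Fintype.card R) ^ 2
      ≤ P.card * ((nonunits R).ncard * Fintype.card R) := by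
  have hN : (Fintype.card R : ℝ) ≠ 0 := by exact_mod_cast Fintype.card_ne_zero
  have h1 : ∑ l : R × R, ((pointsOn P l).card : ℝ) = P.card * Fintype.card R := by
    exact_mod_cast sum_card_pointsOn P
  have h2 : ∑ l : R × R, ((pointsOn P l).card : ℝ) ^ 2
      ≤ P.card * (P.card + (nonunits R).ncard * Fintype.card R) := by
    exact_mod_cast sum_card_pointsOn_sq_le P
  have h3 : ∑ l : R × R, (((pointsOn P l).card : ℝ) - P.card / Fintype.card R) ^ 2
      = ∑ l : R × R, ((pointsOn P l).card : ℝ) ^ 2 - P.card ^ 2 := by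
    simp only [sub_sq, Finset.sum_add_distrib, Finset.sum_sub_distrib, ← Finset.sum_mul,
      ← Finset.mul_sum, h1, Finset.sum_const, Finset.card_univ, Fintype.card_prod, nsmul_eq_mul]
    push_cast
    field_simp
    ring
  rw [h3]
  linarith

/-- If every line of `L` contains at least `a` points of `P`, and `P` is not so large that this
is explained by the average, then there are few lines in `L`. -/
theorem card_mul_sq_le_of_le_card_pointsOn (P L : Finset (R × R)) (a : ℝ)
    (ha : 0 ≤ a) (hL : ∀ l ∈ L, a ≤ (pointsOn P l).card)
    (hP : (P.card : ℝ) / Fintype.card R ≤ a / 2) :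
    (L.card : ℝ) * a ^ 2 ≤ 4 * P.card * ((nonunits R).ncard * Fintype.card R) := by
  have h1 : ∑ l ∈ L, (a / 2) ^ 2
      ≤ ∑ l ∈ L, (((pointsOn P l).card : ℝ) - P.card / Fintype.card R) ^ 2 := by
    refine Finset.sum_le_sum fun l hl => pow_le_pow_left₀ (by positivity) ?_ 2
    linarith [hL l hl]
  have h2 := Finset.sum_le_sum_of_subset_of_nonneg (Finset.subset_univ L)
    (f := fun l => (((pointsOn P l).card : ℝ) - P.card / Fintype.card R) ^ 2)
    fun _ _ _ => sq_nonneg _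
  have h3 := (h1.trans h2).trans (sum_card_pointsOn_sub_sq_le P)
  rw [Finset.sum_const, nsmul_eq_mul] at h3
  linarith

/-- A lower bound for `|A + A| |A² + A²|` from counting the solutions of `(s - b)² + w = t`. -/
theorem card_add_mul_card_squareSet_add (h2 : IsUnit (2 : R)) (A : Finset R) :
    (A.card : ℝ) * Fintype.card R
        ≤ 2 * ((A + A).card * (squareSet A + squareSet A).card) ∨
      (A.card : ℝ) ^ 3 * (squareSet A).card
        ≤ 4 * ((A + A).card * (squareSet A + squareSet A).card)
          * ((nonunits R).ncard * Fintype.card R) := by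
  have hN : (0 : ℝ) < Fintype.card R := by exact_mod_cast Fintype.card_pos
  set P : Finset (R × R) :=
    ((A + A) ×ˢ (squareSet A + squareSet A)).image (fun x => (x.1, x.2 - x.1 ^ 2)) with hPdef
  set L : Finset (R × R) :=
    (A ×ˢ squareSet A).image (fun x => (-2 * x.1, x.1 ^ 2 + x.2)) with hLdef
  have hPcard : (P.card : ℝ) ≤ (A + A).card * (squareSet A + squareSet A).card := by
    have := Finset.card_image_le (s := (A + A) ×ˢ (squareSet A + squareSet A))
      (f := fun x => (x.1, x.2 - x.1 ^ 2))
    rw [Finset.card_product] at this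
    exact_mod_cast this
  have hLcard : L.card = A.card * (squareSet A).card := by
    rw [hLdef, Finset.card_image_of_injective, Finset.card_product]
    rintro ⟨b, w⟩ ⟨b', w'⟩ h
    simp only [Prod.mk.injEq] at h
    -- The slope `-2b` recovers `b` because 2 is a unit.
    have hb : b = b' := h2.mul_right_injective (by linear_combination -h.1)
    subst hb
    simpa using h.2
  have hrich : ∀ l ∈ L, A.card ≤ (pointsOn P l).card := by
    intro l hl
    obtain ⟨⟨b, w⟩, hbw, rfl⟩ := Finset.mem_image.1 hl
    rw [Finset.mem_product] at hbw
    refine Finset.card_le_card_of_injOn (fun a => (a + b, a ^ 2 + w - (a + b) ^ 2)) ?_ ?_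
    · intro a ha
      simp only [pointsOn, Finset.coe_filter, Set.mem_ofPred_eq]
      refine ⟨Finset.mem_image.2 ⟨(a + b, a ^ 2 + w), ?_, rfl⟩, by ring⟩
      exact Finset.mem_product.2 ⟨Finset.add_mem_add ha hbw.1,
        Finset.add_mem_add (Finset.mem_image_of_mem _ ha) hbw.2⟩
    · intro a _ a' _ h
      simpa using (Prod.mk.inj h).1
  rcases le_or_gt ((P.card : ℝ) / Fintype.card R) (A.card / 2) with hP | hP
  · right
    have := card_mul_sq_le_of_le_card_pointsOn P L A.card (by positivity)
      (fun l hl => by exact_mod_cast hrich l hl) hP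
    rw [hLcard] at this
    push_cast at this
    have h4 := mul_le_mul_of_nonneg_right hPcard
      (by positivity : (0 : ℝ) ≤ (nonunits R).ncard * Fintype.card R)
    linarith
  · left
    rw [lt_div_iff₀ hN] at hP
    linarith

end Incidence

section LocalRing

variable {R : Type*} [CommRing R] [IsLocalRing R]

theorem isUnit_two_of_odd_card_residueField
    (h : Odd (Nat.card (IsLocalRing.ResidueField R))) : IsUnit (2 : R) := by
  by_contra hu
  have h0 : IsLocalRing.residue R 2 = 0 :=
    (IsLocalRing.residue_eq_zero_iff 2).2 ((IsLocalRing.mem_maximalIdeal 2).2 hu)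
  have h1 : addOrderOf (1 : IsLocalRing.ResidueField R) = 2 := by
    refine addOrderOf_eq_prime ?_ one_ne_zero
    rw [two_nsmul, one_add_one_eq_two, ← map_ofNat (IsLocalRing.residue R) 2, h0]
  have h2 := addOrderOf_dvd_natCard (1 : IsLocalRing.ResidueField R)
  rw [h1] at h2
  exact (Nat.not_even_iff_odd.2 h) (even_iff_two_dvd.2 h2)

theorem card_eq_ncard_nonunits_mul :
    Nat.card R = (nonunits R).ncard * Nat.card (IsLocalRing.ResidueField R) :=
  Submodule.card_eq_card_quotient_mul_card (IsLocalRing.maximalIdeal R)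

/-- The factors `x - y` and `x + y` have unit sum `2x`, so one of them is a unit and the other
vanishes. -/
theorem eq_or_eq_neg_of_isUnit_of_sq_eq_sq (h2 : IsUnit (2 : R)) {x y : R} (hx : IsUnit x)
    (h : x ^ 2 = y ^ 2) : x = y ∨ x = -y := by
  have hprod : (x - y) * (x + y) = 0 := by linear_combination h
  have hsum : IsUnit ((x - y) + (x + y)) := by
    have : (x - y) + (x + y) = 2 * x := by ring
    rw [this]
    exact h2.mul hx
  rcases IsLocalRing.isUnit_or_isUnit_of_isUnit_add hsum with hu | hu
  · exact Or.inr (eq_neg_of_add_eq_zero_left ((hu.mul_right_eq_zero).1 hprod))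
  · exact Or.inl (sub_eq_zero.1 ((hu.mul_left_eq_zero).1 hprod))

/-- At least half of `A` consists of units, where each square has at most two roots. -/
theorem card_le_four_mul_card_squareSet [Finite R] [DecidableEq R] (h2 : IsUnit (2 : R))
    (A : Finset R) (hA : 2 * (nonunits R).ncard ≤ A.card) :
    A.card ≤ 4 * (squareSet A).card := by
  classical
  have hsplit := Finset.card_filter_add_card_filter_not (s := A) (fun x : R => IsUnit x)
  have hnon : (A.filter fun x => ¬ IsUnit x).card ≤ (nonunits R).ncard := by
    rw [← Set.ncard_coe_finset]
    refine Set.ncard_le_ncard ?_ (Set.toFinite _)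
    intro x hx
    simpa using (Finset.mem_filter.1 hx).2
  have hfib : (A.filter fun x => IsUnit x).card
      ≤ 2 * ((A.filter fun x => IsUnit x).image fun x => x ^ 2).card := by
    refine Finset.card_le_mul_card_image _ 2 ?_
    intro y hy
    obtain ⟨x₀, hx₀, rfl⟩ := Finset.mem_image.1 hy
    refine (Finset.card_le_card (t := {x₀, -x₀}) ?_).trans Finset.card_le_two
    intro x hx
    simp only [Finset.mem_filter] at hx
    simpa using eq_or_eq_neg_of_isUnit_of_sq_eq_sq h2 hx.1.2 hx.2
  have himg : ((A.filter fun x => IsUnit x).image fun x => x ^ 2).card ≤ (squareSet A).card :=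
    Finset.card_le_card (Finset.image_subset_image (Finset.filter_subset _ _))
  omega

end LocalRing

/-- The deduction of the cubic lower bound for the maximum `m` of `S = |A + A|` and
`T = |A² + A²|` from the incidence bound, with `a = |A|`, `N = |R|` and `M` the number of
nonunits. -/
theorem le_max_cube {C N M a b S T : ℝ} (hM : 0 < M) (hN : 0 < N) (ha : 0 < a) (haN : a ≤ N)
    (hS : 0 ≤ S) (hT : 0 ≤ T) (hb : a ≤ 4 * b) (hC : C * (N ^ 2 * M) ≤ S * a ^ 2)
    (h : a * N ≤ 2 * (S * T) ∨ a ^ 3 * b ≤ 4 * (S * T) * (M * N)) :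
    min (C / 16) (1 / 4) * (N * a ^ 2) ≤ max S T ^ 3 := by
  set m := max S T
  have hm : 0 ≤ m := hS.trans (le_max_left S T)
  have hST : S * T ≤ m ^ 2 := by
    rw [sq]
    exact mul_le_mul (le_max_left S T) (le_max_right S T) hT hm
  have hNa : 0 < N * a ^ 2 := by positivity
  rcases h with h | h
  · refine (mul_le_mul_of_nonneg_right (min_le_right _ _) hNa.le).trans ?_
    refine (pow_le_pow_iff_left₀ (by positivity) (by positivity) two_ne_zero).1 ?_
    have h1 : a * N / 2 ≤ m ^ 2 := by linarith
    have h2 : (a * N / 2) ^ 3 ≤ (m ^ 2) ^ 3 := pow_le_pow_left₀ (by positivity) h1 3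
    have h3 : a ^ 3 * N ^ 2 * a ≤ a ^ 3 * N ^ 2 * N :=
      mul_le_mul_of_nonneg_left haN (by positivity)
    have h4 : 0 ≤ a ^ 3 * N ^ 2 * a := by positivity
    calc (1 / 4 * (N * a ^ 2)) ^ 2 = a ^ 3 * N ^ 2 * a / 16 := by ring
      _ ≤ (a * N / 2) ^ 3 := by linarith
      _ ≤ (m ^ 2) ^ 3 := h2
      _ = (m ^ 3) ^ 2 := by ring
  · refine (mul_le_mul_of_nonneg_right (min_le_left _ _) hNa.le).trans ?_
    -- The extra factor `S` brings in the hypothesis on `S * a ^ 2`.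
    have h1 : S * (S * T) ≤ m ^ 3 := by
      calc S * (S * T) ≤ m * m ^ 2 :=
            mul_le_mul (le_max_left S T) hST (by positivity) hm
        _ = m ^ 3 := by ring
    refine le_trans ?_ h1
    refine le_of_mul_le_mul_right ?_ (by positivity : 0 < 16 * (M * N))
    have h2 : a ^ 2 * (C * (N ^ 2 * M)) ≤ a ^ 2 * (S * a ^ 2) :=
      mul_le_mul_of_nonneg_left hC (by positivity)
    have h3 : S * a ^ 3 * a ≤ S * a ^ 3 * (4 * b) :=
      mul_le_mul_of_nonneg_left hb (by positivity)
    have h4 : S * (a ^ 3 * b) ≤ S * (4 * (S * T) * (M * N)) :=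
      mul_le_mul_of_nonneg_left h hS
    linarith

/-- `R` is a finite valuation ring (commutative, finite, local, principal); `q` is the cardinality
of its residue field and `|R| = q ^ r`.  A local ring is nontrivial, so `r ≥ 1` and the
subtractions in the exponents below are genuine.  The implied constant `c` in the conclusion
depends only on the implied constant `C` in the hypothesis. -/
theorem theorem1p5 :
    ∀ C : ℝ, 0 < C → ∃ c : ℝ, 0 < c ∧
      ∀ (R : Type*) [CommRing R] [Finite R] [IsLocalRing R] [IsPrincipalIdealRing R]
        [DecidableEq R] (q r : ℕ),
        Nat.card (IsLocalRing.ResidueField R) = q → Nat.card R = q ^ r → Odd q →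
        ∀ A : Finset R,
          2 * q ^ (r - 1) ≤ A.card →
          ((A + A).card : ℝ) * (A.card : ℝ) ^ 2 ≥ C * (q : ℝ) ^ (3 * r - 1) →
          max ((A + A).card : ℝ) ((squareSet A + squareSet A).card : ℝ)
            ≥ c * ((q : ℝ) ^ ((r : ℝ) / 3) * (A.card : ℝ) ^ ((2 : ℝ) / 3)) := by
  intro C hC
  set c₀ : ℝ := min (C / 16) (1 / 4)
  have hc₀ : 0 < c₀ := lt_min (by positivity) (by norm_num)
  refine ⟨c₀ ^ ((1 : ℝ) / 3), by positivity, ?_⟩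
  intro R _ _ _ _ _ q r hq hr hodd A hA hAA
  have := Fintype.ofFinite R
  have h2 : IsUnit (2 : R) := isUnit_two_of_odd_card_residueField (hq ▸ hodd)
  have hqpos : 0 < q := hodd.pos
  have hr0 : r ≠ 0 := by
    rintro rfl
    have : 1 < Nat.card R := Finite.one_lt_card
    rw [hr, pow_zero] at this
    exact lt_irrefl _ this
  have hM : (nonunits R).ncard = q ^ (r - 1) := by
    have h := card_eq_ncard_nonunits_mul (R := R)
    rw [hr, hq, ← pow_sub_one_mul hr0] at h
    exact (Nat.eq_of_mul_eq_mul_right hqpos h).symm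
  have hN : Fintype.card R = q ^ r := by rw [← Nat.card_eq_fintype_card, hr]
  have hq' : (0 : ℝ) < q := by exact_mod_cast hqpos
  have hapos : 0 < A.card := lt_of_lt_of_le (by positivity) hA
  have hinc := card_add_mul_card_squareSet_add h2 A
  rw [hM, hN] at hinc
  push_cast at hinc
  have hcube := le_max_cube (C := C) (N := (q : ℝ) ^ r) (M := (q : ℝ) ^ (r - 1))
    (a := A.card) (b := (squareSet A).card) (S := (A + A).card)
    (T := (squareSet A + squareSet A).card) (by positivity) (by positivity)
    (by exact_mod_cast hapos) (by exact_mod_cast hN ▸ A.card_le_univ) (by positivity)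
    (by positivity)
    (by exact_mod_cast card_le_four_mul_card_squareSet h2 A (hM ▸ hA))
    (by
      -- `q ^ (3r - 1)` is `N² M`.
      have : 3 * r - 1 = r * 2 + (r - 1) := by omega
      rwa [ge_iff_le, this, pow_add, pow_mul] at hAA) hinc
  refine (pow_le_pow_iff_left₀ (by positivity) (by positivity) three_ne_zero).1 ?_
  refine le_of_eq_of_le ?_ hcube
  rw [mul_pow, mul_pow, ← Real.rpow_mul_natCast hc₀.le, ← Real.rpow_mul_natCast hq'.le,
    ← Real.rpow_mul_natCast (Nat.cast_nonneg _), ← Real.rpow_natCast (q : ℝ) r,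
    ← Real.rpow_natCast (A.card : ℝ) 2]
  norm_num [c₀]
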